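/- **Setting.** Let $S^1,S^2$ be finite sets, $Q=S^1\cap S^2$, with $S^i\setminus Q\neq\emptyset$ for $i=1,2$. For a finite or infinite sequence of elements of $S^i$, its *$Q$-sequence* is the (finite or infinite) sequence of its terms lying in $Q$, in order of appearance. A *finite trajectory* is a pair $s=(s^1,s^2)$ of finite sequences, $s^i$ in $S^i$, with equal $Q$-sequences; its length is $|s|=(|s^1|,|s^2|)\in\mathbb N\times\mathbb N$. Let $\Omega$ be the set of pairs $\omega=(\omega^1,\omega^2)$ of infinite sequences, $\omega^i$ in $S^i$, with equal $Q$-sequences. Trajectories are concatenated, and ordered by the prefix order, component by component (lengths are ordered componentwise as well); $\uparrow s=\{\omega\in\Omega: s\le\omega\}$, and $\Omega$ carries the $\sigma$-algebra generated by the sets $\uparrow s$. For a probability measure $\mathbf P$ on $\Omega$ write $\mathbf P(s)=\mathbf P(\uparrow s)$. A *global state* is an element $\alpha=(x,y)$ of $S^1\times S^2$, and $\gamma_\alpha(s)$ is the pair of the last terms of $x\cdot s^1$ and $y\cdot s^2$. A *Markov two-components process* (M2CP) is a family $(\mathbf P_\alpha)_{\alpha\in X_0}$ of probability measures on $\Omega$,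 indexed by a nonempty set $X_0$ of global states, such that for every $\alpha\in X_0$ and every finite trajectory $s$ with $\mathbf P_\alpha(s)>0$ one has $\gamma_\alpha(s)\in X_0$ and $\mathbf P_{\gamma_\alpha(s)}(t)=\mathbf P_\alpha(s\cdot t)/\mathbf P_\alpha(s)$ for all finite trajectories $t$. A state $\beta$ is *reachable from* $\alpha\in X_0$ if $\beta=\gamma_\alpha(s)$ for some finite trajectory $s$ with $\mathbf P_\alpha(s)>0$. For $\alpha\in X_0$ and $\omega\in\Omega$ let $N_\alpha(\omega)$ be the set of finite trajectories $v\le\omega$ with $|v|\ge(1,1)$ whose pair of last terms is $\alpha$; if nonempty, it has a least element. The *first return time* is $R_\alpha(\omega)=|\min N_\alpha(\omega)|$, or $\infty$ if $N_\alpha(\omega)=\emptyset$. For $T:\Omega\to(\mathbb N\times\mathbb N)\cup\{\infty\}$ with $T(\omega)<\infty$, let $\omega_T$ be the prefix of $\omega$ of length $T(\omega)$; if $\omega_T$ is a trajectory, let $\theta_T(\omega)\in\Omega$ be defined by $\omega=\omega_T\cdot\theta_T(\omega)$. The successive return times are $R^0_\alpha=(0,0)$ and $R^{n+1}_\alpha=R^n_\alpha+R_\alpha\circ\theta_{R^n_\alpha}$,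 with $R^{n+1}_\alpha=\infty$ where $R^n_\alpha=\infty$. A trajectory $\omega\in\Omega$ *returns infinitely often* to $\alpha$ if $R^n_\alpha(\omega)<\infty$ for all $n\ge1$. The state $\alpha$ is *recurrent* if $\mathbf P_\alpha\bigl(\bigcap_{n\ge1}\{R^n_\alpha<\infty\}\bigr)=1$ and *transient* if this probability is $0$. **Proposition.** Let $(\mathbf P_\alpha)_{\alpha\in X_0}$ be an M2CP. 1. For every $\alpha\in X_0$, the events $\{R_\alpha<\infty\}$ and $\bigcap_{n\ge1}\{R^n_\alpha<\infty\}$ are measurable, and the latter has $\mathbf P_\alpha$-probability $0$ or $1$. Moreover $\alpha$ is recurrent if and only if $\mathbf P_\alpha(R_\alpha<\infty)=1$, and $\alpha$ is transient if and only if $\mathbf P_\alpha(R_\alpha<\infty)<1$. 2. There is at least one recurrent state in $X_0$. 3. If $\alpha\in X_0$ is recurrent, then the successive returning trajectories $\rho_n=\bigl(\theta_{R^{n-1}_\alpha}(\omega)\bigr)_{R_\alpha}$, $n\ge1$, are $\mathbf P_\alpha$-almost surely all defined and finite, and they form a sequence of independent and identically distributed random finite trajectories with respect to $\mathbf P_\alpha$.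 4. If $\alpha\in X_0$ is recurrent and $\beta$ is reachable from $\alpha$, then $\beta$ is recurrent and $\alpha$ is reachable from $\beta$. -/

import Mathlib

open MeasureTheory ProbabilityTheory
open scoped ENNReal

namespace TwoComp

/-- A distributed system: two finite sets of local states inside a common type, each site having
at least one private state. -/
structure DistributedSystem (V : Type*) where
  S₁ : Set V
  S₂ : Set V
  finite₁ : S₁.Finite
  finite₂ : S₂.Finite
  private₁ : (S₁ \ S₂).Nonempty
  private₂ : (S₂ \ S₁).Nonempty

/-- The list of the first `m` terms of an infinite sequence. -/
def trunc {S : Type*} (x : ℕ → S) (m : ℕ) : List S := (List.range m).map x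

section Sequences

open Classical

variable {V : Type*}

/-- The `A`-sequence induced by a finite sequence. -/
noncomputable def inducedList (A : Set V) {B : Set V} (l : List B) : List V :=
  (l.map Subtype.val).filter (fun v => v ∈ A)

/-- The `A`-sequence induced by an infinite sequence. It may be finite, so it is continued with
the value `none` after its last term. -/
noncomputable def inducedSeq (A : Set V) {B : Set V} (x : ℕ → B) (n : ℕ) : Option V :=
  if ∃ k, n < Nat.count (fun j => (x j : V) ∈ A) k then
    some (x (Nat.nth (fun j => (x j : V) ∈ A) n))
  else none

end Sequences

variable {V : Type*}

/-- The set of shared states. -/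
def DistributedSystem.Q (D : DistributedSystem V) : Set V := D.S₁ ∩ D.S₂

/-- Global states. -/
abbrev GlobalState (D : DistributedSystem V) : Type _ := D.S₁ × D.S₂

/-- Finite trajectories: pairs of finite local trajectories that synchronize. -/
@[ext]
structure FinTraj (D : DistributedSystem V) where
  fst : List D.S₁
  snd : List D.S₂
  sync : inducedList D.Q fst = inducedList D.Q snd

/-- Maximal trajectories (the space `Ω`): pairs of infinite local trajectories that
synchronize. -/
@[ext]
structure MaxTraj (D : DistributedSystem V) where
  fst : ℕ → D.S₁
  snd : ℕ → D.S₂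
  sync : inducedSeq D.Q fst = inducedSeq D.Q snd

theorem inducedList_append (A : Set V) {B : Set V} (l l' : List B) :
    inducedList A (l ++ l') = inducedList A l ++ inducedList A l' := by
  simp [inducedList]

theorem trunc_length {S : Type*} (x : ℕ → S) (m : ℕ) : (trunc x m).length = m := by
  simp [trunc]

theorem trunc_add {S : Type*} (x : ℕ → S) (m n : ℕ) :
    trunc x (m + n) = trunc x m ++ trunc (fun k => x (m + k)) n := by
  simp [trunc, List.range_add, Function.comp_def]

variable {D : DistributedSystem V}

namespace FinTraj

/-- Componentwise prefix order. -/
instance : PartialOrder (FinTraj D) where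
  le s t := s.fst <+: t.fst ∧ s.snd <+: t.snd
  le_refl s := ⟨List.prefix_refl _, List.prefix_refl _⟩
  le_trans s t u h h' := ⟨h.1.trans h'.1, h.2.trans h'.2⟩
  le_antisymm s t h h' := by
    ext1
    · exact h.1.eq_of_length (le_antisymm h.1.length_le h'.1.length_le)
    · exact h.2.eq_of_length (le_antisymm h.2.length_le h'.2.length_le)

/-- Concatenation. -/
def append (s t : FinTraj D) : FinTraj D where
  fst := s.fst ++ t.fst
  snd := s.snd ++ t.snd
  sync := by rw [inducedList_append, inducedList_append, s.sync, t.sync]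

/-- Length of a finite trajectory. -/
def length (s : FinTraj D) : ℕ × ℕ := (s.fst.length, s.snd.length)

/-- The global state `γ_α(s)` reached after `s`, starting from `α`. -/
def gamma (α : GlobalState D) (s : FinTraj D) : GlobalState D :=
  (s.fst.getLastD α.1, s.snd.getLastD α.2)

/-- `s ≤ ω` for a finite trajectory `s` and a maximal trajectory `ω`. -/
def IsPrefix (s : FinTraj D) (ω : MaxTraj D) : Prop :=
  trunc ω.fst s.fst.length = s.fst ∧ trunc ω.snd s.snd.length = s.snd

/-- The elementary cylinder of base `s`. -/
def cylinder (s : FinTraj D) : Set (MaxTraj D) := {ω | s.IsPrefix ω}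

/-- Random excursions take their values in the countable set of finite trajectories, to which one
point `none` is added; it carries the discrete σ-algebra. -/
instance : MeasurableSpace (Option (FinTraj D)) := ⊤

end FinTraj

/-- The σ-algebra on `Ω` generated by the elementary cylinders. -/
instance : MeasurableSpace (MaxTraj D) :=
  MeasurableSpace.generateFrom (Set.range FinTraj.cylinder)

section Shift

open Classical

theorem count_trunc (A : Set V) {B : Set V} (x : ℕ → B) (m : ℕ) :
    (inducedList A (trunc x m)).length = Nat.count (fun j => (x j : V) ∈ A) m := by
  induction m with
  | zero => simp [trunc, inducedList]
  | succ m ih =>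
    rw [trunc_add, inducedList_append, List.length_append, ih, Nat.count_succ]
    by_cases h : (x m : V) ∈ A <;> simp [trunc, inducedList, h]

theorem inducedSeq_shift (A : Set V) {B : Set V} (x : ℕ → B) (m n : ℕ) :
    inducedSeq A (fun k => x (m + k)) n =
      inducedSeq A x ((inducedList A (trunc x m)).length + n) := by
  rw [count_trunc]
  set p : ℕ → Prop := fun j => (x j : V) ∈ A with hp
  have hadd : ∀ k, Nat.count p (m + k) = Nat.count p m + Nat.count (fun j => p (m + j)) k :=
    fun k => Nat.count_add p m k
  have hex : (∃ k, n < Nat.count (fun j => p (m + j)) k) ↔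
      ∃ k, Nat.count p m + n < Nat.count p k := by
    constructor
    · rintro ⟨k, hk⟩
      exact ⟨m + k, by rw [hadd]; omega⟩
    · rintro ⟨k, hk⟩
      refine ⟨k, ?_⟩
      have : Nat.count p k ≤ Nat.count p (m + k) := Nat.count_monotone p (by omega)
      rw [hadd] at this
      omega
  unfold inducedSeq
  by_cases h : ∃ k, n < Nat.count (fun j => p (m + j)) k
  · rw [if_pos h, if_pos (hex.1 h)]
    obtain ⟨k, hk⟩ := h
    have hfin : ∀ hf : {j | p (m + j)}.Finite, n < hf.toFinset.card := by
      intro hf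
      refine lt_of_lt_of_le hk ?_
      rw [Nat.count_eq_card_filter_range]
      apply Finset.card_le_card
      intro j hj
      exact hf.mem_toFinset.2 (Finset.mem_filter.1 hj).2
    have h1 : p (m + Nat.nth (fun j => p (m + j)) n) := Nat.nth_mem n hfin
    have h2 : Nat.count (fun j => p (m + j)) (Nat.nth (fun j => p (m + j)) n) = n :=
      Nat.count_nth hfin
    have h3 := Nat.nth_count h1
    rw [hadd, h2] at h3
    rw [h3]
  · rw [if_neg h, if_neg (fun h' => h (hex.2 h'))]

end Shift

namespace MaxTraj

/-- The prefix of `ω` of length `t` is a trajectory. -/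
def IsCut (ω : MaxTraj D) (t : ℕ × ℕ) : Prop :=
  inducedList D.Q (trunc ω.fst t.1) = inducedList D.Q (trunc ω.snd t.2)

/-- The subtrajectory of `ω` of length `t`. -/
def take (ω : MaxTraj D) (t : ℕ × ℕ) (h : ω.IsCut t) : FinTraj D where
  fst := trunc ω.fst t.1
  snd := trunc ω.snd t.2
  sync := h

/-- What remains of `ω` after its subtrajectory of length `t`. -/
def drop (ω : MaxTraj D) (t : ℕ × ℕ) (h : ω.IsCut t) : MaxTraj D where
  fst := fun k => ω.fst (t.1 + k)
  snd := fun k => ω.snd (t.2 + k)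
  sync := by
    funext n
    rw [inducedSeq_shift, inducedSeq_shift, h, ω.sync]

theorem isCut_zero (ω : MaxTraj D) : ω.IsCut 0 := by
  simp [IsCut, trunc, inducedList]

theorem isCut_add (ω : MaxTraj D) (t u : ℕ × ℕ) (h : ω.IsCut t) (h' : (ω.drop t h).IsCut u) :
    ω.IsCut (t + u) := by
  unfold IsCut at *
  rw [Prod.fst_add, Prod.snd_add, trunc_add, trunc_add, inducedList_append, inducedList_append, h]
  exact congrArg _ h'

end MaxTraj

/-- Random times: maps `T` from `Ω` to `(ℕ × ℕ) ∪ {∞}` such that, wherever `T(ω)` is finite, the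
prefix of `ω` of length `T(ω)` is a subtrajectory of `ω`. -/
structure RandomTime (D : DistributedSystem V) where
  toFun : MaxTraj D → WithTop (ℕ × ℕ)
  isCut : ∀ (ω : MaxTraj D) (t : ℕ × ℕ), toFun ω = t → ω.IsCut t

namespace RandomTime

instance : CoeFun (RandomTime D) (fun _ => MaxTraj D → WithTop (ℕ × ℕ)) := ⟨toFun⟩

theorem isCut_untop (T : RandomTime D) (ω : MaxTraj D) (h : T ω ≠ ⊤) :
    ω.IsCut ((T ω).untop h) := T.isCut ω _ (WithTop.coe_untop _ _).symm

open Classical in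
/-- The prefix `ω_T` where `T` is finite, `none` where `T` is infinite. -/
noncomputable def stopped (T : RandomTime D) (ω : MaxTraj D) : Option (FinTraj D) :=
  if h : T ω ≠ ⊤ then some (ω.take ((T ω).untop h) (T.isCut_untop ω h)) else none

open Classical in
/-- The shift operator `θ_T`, undefined (`none`) where `T` is infinite. -/
noncomputable def shift (T : RandomTime D) (ω : MaxTraj D) : Option (MaxTraj D) :=
  if h : T ω ≠ ⊤ then some (ω.drop ((T ω).untop h) (T.isCut_untop ω h)) else none

/-- The constant time `(0,0)`. -/
def zero : RandomTime D where
  toFun _ := ((0 : ℕ × ℕ) : WithTop (ℕ × ℕ))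
  isCut ω t h := by
    rw [← WithTop.coe_injective h]
    exact ω.isCut_zero

open Classical in
/-- The random time `S + T ∘ θ_S`, equal to `∞` where `S` is. -/
noncomputable def add (S T : RandomTime D) : RandomTime D where
  toFun ω := if h : S ω ≠ ⊤ then S ω + T (ω.drop ((S ω).untop h) (S.isCut_untop ω h)) else ⊤
  isCut ω t ht := by
    by_cases h : S ω ≠ ⊤
    · rw [dif_pos h] at ht
      obtain ⟨a, b, ha, hb, hab⟩ := WithTop.add_eq_coe.1 ht
      have hu : (S ω).untop h = a := by simp [← ha]
      rw [← hab]
      refine ω.isCut_add a b (S.isCut ω a ha.symm) ?_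
      have := T.isCut _ b hb.symm
      simpa only [hu] using this
    · rw [dif_neg h] at ht
      exact absurd ht WithTop.top_ne_coe

/-- Iterated times: `T⁰ = (0,0)` and `Tⁿ⁺¹ = Tⁿ + T ∘ θ_{Tⁿ}`. -/
noncomputable def iter (T : RandomTime D) : ℕ → RandomTime D
  | 0 => zero
  | n + 1 => (iter T n).add T

end RandomTime

/-- The finite subtrajectories `v` of `ω` with `γ(v) = α` and `|v| ≥ (1,1)`. The initial state used
in `γ` is immaterial, since both components of `v` are nonempty. -/
def returnSet (α : GlobalState D) (ω : MaxTraj D) : Set (FinTraj D) :=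
  {v | v.IsPrefix ω ∧ v.gamma α = α ∧ (1, 1) ≤ v.length}

theorem trunc_prefix {S : Type*} (x : ℕ → S) {m n : ℕ} (h : m ≤ n) :
    trunc x m <+: trunc x n := by
  obtain ⟨k, rfl⟩ := Nat.exists_eq_add_of_le h
  rw [trunc_add]
  exact List.prefix_append _ _

theorem inducedList_prefix (A : Set V) {B : Set V} {l l' : List B} (h : l <+: l') :
    inducedList A l <+: inducedList A l' := by
  obtain ⟨k, rfl⟩ := h
  rw [inducedList_append]
  exact List.prefix_append _ _

theorem exists_isLeast_returnSet (α : GlobalState D) (ω : MaxTraj D)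
    (h : (returnSet α ω).Nonempty) : ∃ v, IsLeast (returnSet α ω) v := by
  classical
  obtain ⟨v, hv, hvmin⟩ := (measure fun v : FinTraj D => v.fst.length).wf.has_min _ h
  obtain ⟨w, hw, hwmin⟩ := (measure fun v : FinTraj D => v.snd.length).wf.has_min _ h
  have hvm : ∀ u ∈ returnSet α ω, v.fst.length ≤ u.fst.length := fun u hu => not_lt.1 (hvmin u hu)
  have hwm : ∀ u ∈ returnSet α ω, w.snd.length ≤ u.snd.length := fun u hu => not_lt.1 (hwmin u hu)
  have h1 : v.fst <+: w.fst := by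
    rw [← hv.1.1, ← hw.1.1]; exact trunc_prefix _ (hvm w hw)
  have h2 : w.snd <+: v.snd := by
    rw [← hv.1.2, ← hw.1.2]; exact trunc_prefix _ (hwm v hv)
  have h3 := inducedList_prefix D.Q h1
  have h4 := inducedList_prefix D.Q h2
  have hsync : inducedList D.Q v.fst = inducedList D.Q w.snd := by
    rw [← w.sync]
    refine h3.eq_of_length (le_antisymm h3.length_le ?_)
    rw [w.sync, v.sync]
    exact h4.length_le
  refine ⟨⟨v.fst, w.snd, hsync⟩, ⟨⟨hv.1.1, hw.1.2⟩, ?_, ?_⟩, ?_⟩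
  · have e1 : v.fst.getLastD α.1 = α.1 := congrArg Prod.fst hv.2.1
    have e2 : w.snd.getLastD α.2 = α.2 := congrArg Prod.snd hw.2.1
    exact Prod.ext e1 e2
  · exact ⟨hv.2.2.1, hw.2.2.2⟩
  · intro u hu
    constructor
    · change v.fst <+: u.fst
      rw [← hv.1.1, ← hu.1.1]; exact trunc_prefix _ (hvm u hu)
    · change w.snd <+: u.snd
      rw [← hw.1.2, ← hu.1.2]; exact trunc_prefix _ (hwm u hu)

open Classical in
/-- The first return time `R_α`: the length of the least element of `returnSet α ω`, and `∞` if
this set is empty. -/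
noncomputable def returnTime (α : GlobalState D) : RandomTime D where
  toFun ω := if h : (returnSet α ω).Nonempty then
    ((exists_isLeast_returnSet α ω h).choose.length : WithTop (ℕ × ℕ)) else ⊤
  isCut ω t ht := by
    by_cases h : (returnSet α ω).Nonempty
    · rw [dif_pos h] at ht
      have hs := (exists_isLeast_returnSet α ω h).choose_spec.1.1
      rw [← WithTop.coe_injective ht]
      generalize (exists_isLeast_returnSet α ω h).choose = v at hs
      unfold MaxTraj.IsCut
      have := v.sync
      rw [← hs.1, ← hs.2] at this
      simpa [FinTraj.length, trunc_length] using this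
    · rw [dif_neg h] at ht
      exact absurd ht WithTop.top_ne_coe

/-- The maximal trajectories that return infinitely often to `α`. -/
def returnsInfinitelyOften (α : GlobalState D) : Set (MaxTraj D) :=
  {ω | ∀ n, 1 ≤ n → (returnTime α).iter n ω ≠ ⊤}

/-- The successive returning trajectories to `α`: `returningTraj α n` is
`ρ_{n+1}(ω) = (θ_{Rⁿ}(ω))_R` with `R = R_α`, where `n = 0, 1, 2, …`. The value is `none` if
`ρ_{n+1}(ω)` is undefined or infinite, that is, if `Rⁿ⁺¹(ω) = ∞`. -/
noncomputable def returningTraj (α : GlobalState D) (n : ℕ) (ω : MaxTraj D) :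
    Option (FinTraj D) :=
  (((returnTime α).iter n).shift ω).bind (returnTime α).stopped

/-- `β` is reachable with respect to the probability measure `μ`, the initial state being `α`. -/
def ReachableWrt (μ : Measure (MaxTraj D)) (α β : GlobalState D) : Prop :=
  ∃ s : FinTraj D, 0 < μ s.cylinder ∧ s.gamma α = β

/-- `ν` is the probabilistic future of `s` with respect to `μ`, for probability measures `μ` and
`ν`. It is characterized by its values on cylinders. -/
def IsFuture (μ : Measure (MaxTraj D)) (s : FinTraj D) (ν : Measure (MaxTraj D)) : Prop :=
  ∀ t : FinTraj D, ν t.cylinder = μ (s.append t).cylinder / μ s.cylinder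

/-- Probabilistic two-components processes. -/
structure ProbProcess (D : DistributedSystem V) where
  X₀ : Set (GlobalState D)
  P : X₀ → Measure (MaxTraj D)
  isProbabilityMeasure : ∀ α, IsProbabilityMeasure (P α)
  mem_of_reachable : ∀ (α : X₀) (β : GlobalState D), ReachableWrt (P α) α β → β ∈ X₀

namespace ProbProcess

/-- `β` is reachable from `α`. -/
def Reachable (p : ProbProcess D) (α β : p.X₀) : Prop := ReachableWrt (p.P α) α β

/-- Markov two-components processes: `(P_α)_s = P_{γ(s)}` whenever `P_α(s) > 0`. In this case
`γ(s)` is reachable from `α`, hence automatically in `X₀`. -/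
def IsMarkov (p : ProbProcess D) : Prop :=
  ∀ (α β : p.X₀) (s : FinTraj D), 0 < p.P α s.cylinder → s.gamma α = β →
    IsFuture (p.P α) s (p.P β)

/-- Recurrent global states. -/
def Recurrent (p : ProbProcess D) (α : p.X₀) : Prop :=
  p.P α (returnsInfinitelyOften (α : GlobalState D)) = 1

/-- Transient global states. -/
def Transient (p : ProbProcess D) (α : p.X₀) : Prop :=
  p.P α (returnsInfinitelyOften (α : GlobalState D)) = 0

end ProbProcess

end TwoComp

namespace TwoComp

variable {V : Type*} {D : DistributedSystem V}

/-! The first return times are not compared with each other; two facts replace them. First, the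
trajectories that are minimal among those ending in `α` with length at least `(1,1)` have pairwise
disjoint cylinders, because the least element of `returnSet` is unique. There are countably many of
them, so summing the Markov property over them gives a strong Markov property
(`measure_biUnion_followedBy`): the probability of reaching `β` and then realizing `E` is the
probability of reaching `β` times `P β E`. Second, returning infinitely often to `α` is the same as
having arbitrarily long prefixes ending in `α` (`returnsInfinitelyOften_eq`), an event that does not
change when a finite prefix is removed.

Let `x` be the probability under `P α` of infinitely many visits to `α`, and `r` that of `R_α < ∞`.
The two facts give `x = r * x`, so `x = 0` if `r < 1`. If `r = 1`, first returns can be put in front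
of any `s` at no cost, so `P α s` is at most the probability of visiting the end state of `s`
infinitely often; the empty `s` gives `x = 1`.

There are finitely many global states, so by pigeonhole every maximal trajectory visits one of them
infinitely often, and some state `β` is so visited with positive probability. Then `P β` also gives
these visits positive probability, so `β` is recurrent. The same argument shows that recurrence
passes to reachable states. The law of the returning trajectories factorizes by splitting off the
first one. -/

theorem trunc_succ {S : Type*} (x : ℕ → S) (m : ℕ) : trunc x (m + 1) = trunc x m ++ [x m] := by
  simp [trunc, List.range_succ]

theorem trunc_eq_append_iff {S : Type*} (x : ℕ → S) (l l' : List S) :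
    trunc x (l ++ l').length = l ++ l' ↔
      trunc x l.length = l ∧ trunc (fun k => x (l.length + k)) l'.length = l' := by
  rw [List.length_append, trunc_add]
  exact ⟨fun h => List.append_inj h (trunc_length _ _), fun h => by rw [h.1, h.2]⟩

/-! ### Prefixes and cylinders -/

namespace FinTraj

/-- The empty trajectory. -/
def empty : FinTraj D := ⟨[], [], rfl⟩

theorem length_append (s t : FinTraj D) : (s.append t).length = s.length + t.length := by
  simp [append, length]

theorem gamma_append (α : GlobalState D) (s t : FinTraj D) :
    (s.append t).gamma α = t.gamma (s.gamma α) := by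
  simp [gamma, append, List.getLastD_eq_getLast?, List.getLast?_append]

theorem gamma_eq_gamma {s : FinTraj D} (h : (1, 1) ≤ s.length) (α β : GlobalState D) :
    s.gamma α = s.gamma β := by
  obtain ⟨l, l', hs⟩ := s
  obtain ⟨h1, h2⟩ := h
  cases l <;> cases l' <;> simp_all [length, gamma, List.getLastD]

theorem isPrefix_empty (ω : MaxTraj D) : (empty : FinTraj D).IsPrefix ω := by
  simp [IsPrefix, empty, trunc]

theorem cylinder_empty : (empty : FinTraj D).cylinder = Set.univ :=
  Set.eq_univ_of_forall isPrefix_empty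

theorem IsPrefix.isCut {s : FinTraj D} {ω : MaxTraj D} (h : s.IsPrefix ω) :
    ω.IsCut s.length := by
  have := s.sync
  rw [← h.1, ← h.2] at this
  exact this

theorem IsPrefix.take_eq {s : FinTraj D} {ω : MaxTraj D} (h : s.IsPrefix ω) :
    ω.take s.length h.isCut = s := by
  ext1
  · exact h.1
  · exact h.2

theorem IsPrefix.of_le {s t : FinTraj D} {ω : MaxTraj D} (h : t.IsPrefix ω) (hst : s ≤ t) :
    s.IsPrefix ω := by
  have aux : ∀ {S : Type _} (x : ℕ → S) (l l' : List S), l <+: l' → trunc x l'.length = l' →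
      trunc x l.length = l := by
    rintro S x l _ ⟨k, rfl⟩ h
    exact ((trunc_eq_append_iff x l k).1 h).1
  exact ⟨aux _ _ _ hst.1 h.1, aux _ _ _ hst.2 h.2⟩

/-- Two prefixes of a maximal trajectory whose lengths are comparable are comparable. -/
theorem IsPrefix.exists_append {s v : FinTraj D} {ω : MaxTraj D} (hs : s.IsPrefix ω)
    (hv : v.IsPrefix ω) (h : s.length ≤ v.length) : ∃ u, v = s.append u := by
  have h1 : s.fst <+: v.fst := by rw [← hs.1, ← hv.1]; exact trunc_prefix _ h.1
  have h2 : s.snd <+: v.snd := by rw [← hs.2, ← hv.2]; exact trunc_prefix _ h.2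
  obtain ⟨a, ha⟩ := h1
  obtain ⟨b, hb⟩ := h2
  refine ⟨⟨a, b, ?_⟩, ?_⟩
  · have := v.sync
    rw [← ha, ← hb, inducedList_append, inducedList_append, s.sync] at this
    exact List.append_cancel_left this
  · ext1
    · exact ha.symm
    · exact hb.symm

/-- If the lengths are comparable, one cylinder contains the other. Otherwise the longer component
is taken on each side. This pair synchronizes: the `Q`-sequences form a circular chain of prefixes,
hence are all equal. -/
theorem isPiSystem_cylinder : IsPiSystem (Set.range (cylinder : FinTraj D → Set (MaxTraj D))) := by
  rintro _ ⟨s, rfl⟩ _ ⟨t, rfl⟩ ⟨ω, hs, ht⟩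
  have key : ∀ s t : FinTraj D, s.IsPrefix ω → t.IsPrefix ω →
      s.fst.length ≤ t.fst.length → t.snd.length ≤ s.snd.length →
      s.cylinder ∩ t.cylinder ∈ Set.range (cylinder : FinTraj D → Set (MaxTraj D)) := by
    intro s t hs ht h1 h2
    have p1 : s.fst <+: t.fst := by rw [← hs.1, ← ht.1]; exact trunc_prefix _ h1
    have p2 : t.snd <+: s.snd := by rw [← hs.2, ← ht.2]; exact trunc_prefix _ h2
    have q1 := inducedList_prefix D.Q p1
    have q2 := inducedList_prefix D.Q p2
    have hsync : inducedList D.Q t.fst = inducedList D.Q s.snd := by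
      rw [← s.sync]
      refine (q1.eq_of_length (le_antisymm q1.length_le ?_)).symm
      rw [s.sync, t.sync]
      exact q2.length_le
    refine ⟨⟨t.fst, s.snd, hsync⟩, ?_⟩
    ext ω'
    refine ⟨fun h => ⟨?_, ?_⟩, fun h => ⟨h.2.1, h.1.2⟩⟩
    · exact IsPrefix.of_le h ⟨p1, List.prefix_refl _⟩
    · exact IsPrefix.of_le h ⟨List.prefix_refl _, p2⟩
  rcases le_total s.fst.length t.fst.length with h1 | h1 <;>
    rcases le_total s.snd.length t.snd.length with h2 | h2
  · obtain ⟨u, hu⟩ := IsPrefix.exists_append hs ht ⟨h1, h2⟩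
    refine ⟨t, (Set.inter_eq_right.2 fun ω' h => ?_).symm⟩
    exact IsPrefix.of_le h (by rw [hu]; exact ⟨List.prefix_append _ _, List.prefix_append _ _⟩)
  · exact key s t hs ht h1 h2
  · rw [Set.inter_comm]
    exact key t s ht hs h1 h2
  · obtain ⟨u, hu⟩ := IsPrefix.exists_append ht hs ⟨h1, h2⟩
    refine ⟨s, (Set.inter_eq_left.2 fun ω' h => ?_).symm⟩
    exact IsPrefix.of_le h (by rw [hu]; exact ⟨List.prefix_append _ _, List.prefix_append _ _⟩)

instance : Countable (FinTraj D) := by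
  have := D.finite₁.to_subtype
  have := D.finite₂.to_subtype
  refine Function.Injective.countable (f := fun s : FinTraj D => (s.fst, s.snd)) ?_
  intro s t h
  ext1
  · exact congrArg Prod.fst h
  · exact congrArg Prod.snd h

theorem measurableSet_cylinder (s : FinTraj D) : MeasurableSet s.cylinder :=
  MeasurableSpace.measurableSet_generateFrom ⟨s, rfl⟩

end FinTraj

/-! ### Removing a prefix -/

open Classical in
/-- What remains of `ω` after its prefix `s`; it is `ω` itself if the prefix of `ω` of length `|s|`
is not a trajectory. -/
noncomputable def MaxTraj.after (s : FinTraj D) (ω : MaxTraj D) : MaxTraj D :=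
  if h : ω.IsCut s.length then ω.drop s.length h else ω

namespace FinTraj

theorem IsPrefix.after_eq {s : FinTraj D} {ω : MaxTraj D} (h : s.IsPrefix ω) :
    ω.after s = ω.drop s.length h.isCut := dif_pos _

theorem isPrefix_append_iff (s t : FinTraj D) (ω : MaxTraj D) :
    (s.append t).IsPrefix ω ↔ s.IsPrefix ω ∧ t.IsPrefix (ω.after s) := by
  have aux (hs : s.IsPrefix ω) : (s.append t).IsPrefix ω ↔ t.IsPrefix (ω.after s) := by
    rw [hs.after_eq]
    unfold IsPrefix append
    rw [trunc_eq_append_iff, trunc_eq_append_iff]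
    exact ⟨fun h => ⟨h.1.2, h.2.2⟩, fun h => ⟨⟨hs.1, h.1⟩, hs.2, h.2⟩⟩
  have hle : s ≤ s.append t := ⟨List.prefix_append _ _, List.prefix_append _ _⟩
  exact ⟨fun h => ⟨h.of_le hle, (aux (h.of_le hle)).1 h⟩, fun h => (aux h.1).2 h.2⟩

/-- The maximal trajectories that start with `s` and continue in `E`. -/
def followedBy (s : FinTraj D) (E : Set (MaxTraj D)) : Set (MaxTraj D) :=
  s.cylinder ∩ {ω | ω.after s ∈ E}

theorem followedBy_cylinder (s t : FinTraj D) :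
    s.followedBy t.cylinder = (s.append t).cylinder := by
  ext ω
  exact (isPrefix_append_iff s t ω).symm

theorem followedBy_subset (s : FinTraj D) (E : Set (MaxTraj D)) : s.followedBy E ⊆ s.cylinder :=
  Set.inter_subset_left

theorem followedBy_compl (s : FinTraj D) (E : Set (MaxTraj D)) :
    s.followedBy Eᶜ = s.cylinder \ s.followedBy E := by
  ext ω
  simp only [followedBy, Set.mem_inter_iff, Set.mem_ofPred_eq, Set.mem_compl_iff, Set.mem_sdiff]
  tauto

theorem followedBy_iUnion (s : FinTraj D) (f : ℕ → Set (MaxTraj D)) :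
    s.followedBy (⋃ i, f i) = ⋃ i, s.followedBy (f i) := by
  ext ω
  simp [followedBy]

theorem measurableSet_followedBy (s : FinTraj D) {E : Set (MaxTraj D)} (hE : MeasurableSet E) :
    MeasurableSet (s.followedBy E) := by
  induction E, hE using MeasurableSpace.generateFrom_induction with
  | hC t ht =>
    obtain ⟨t, rfl⟩ := ht
    rw [followedBy_cylinder]
    exact measurableSet_cylinder _
  | empty => simp [followedBy]
  | compl t ht ih =>
    rw [followedBy_compl]
    exact s.measurableSet_cylinder.diff ih
  | iUnion f hf ih =>
    rw [followedBy_iUnion]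
    exact MeasurableSet.iUnion ih

end FinTraj

/-! ### The Markov property for events -/

namespace ProbProcess

/-- The Markov property, for arbitrary events. -/
theorem IsMarkov.measure_followedBy {p : ProbProcess D} (hp : p.IsMarkov) {α β : p.X₀}
    {s : FinTraj D} (hs : s.gamma α = β) {E : Set (MaxTraj D)} (hE : MeasurableSet E) :
    p.P α (s.followedBy E) = p.P α s.cylinder * p.P β E := by
  have := p.isProbabilityMeasure α
  have := p.isProbabilityMeasure β
  -- The Markov hypothesis only concerns trajectories of positive probability; for the others both
  -- sides vanish.
  rcases eq_or_ne (p.P α s.cylinder) 0 with h0 | h0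
  · rw [h0, zero_mul]
    exact measure_mono_null Set.inter_subset_left h0
  induction E, hE using MeasurableSpace.induction_on_inter (s := Set.range FinTraj.cylinder) rfl
    FinTraj.isPiSystem_cylinder with
  | empty => simp [FinTraj.followedBy]
  | basic t ht =>
    obtain ⟨t, rfl⟩ := ht
    rw [hp α β s (pos_iff_ne_zero.2 h0) hs t, FinTraj.followedBy_cylinder,
      ENNReal.mul_div_cancel h0 (measure_ne_top _ _)]
  | compl t ht ih =>
    rw [FinTraj.followedBy_compl, measure_sdiff (s.followedBy_subset t)
      (s.measurableSet_followedBy ht).nullMeasurableSet (measure_ne_top _ _), ih,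
      measure_compl ht (measure_ne_top _ _), measure_univ,
      ENNReal.mul_sub (fun _ _ => measure_ne_top _ _), mul_one]
  | iUnion f hd hf ih =>
    rw [FinTraj.followedBy_iUnion, measure_iUnion _ fun i => s.measurableSet_followedBy (hf i), measure_iUnion hd hf,
      ← ENNReal.tsum_mul_left]
    · simp_rw [ih]
    · intro i j hij
      refine Set.disjoint_left.2 fun ω h h' => ?_
      exact Set.disjoint_left.1 (hd hij) h.2 h'.2

/-- Decomposition of an event along pairwise incompatible trajectories leading to `β`. -/
theorem IsMarkov.measure_biUnion_followedBy {p : ProbProcess D} (hp : p.IsMarkov) {α β : p.X₀}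
    {F : Set (FinTraj D)} (hF : ∀ v ∈ F, v.gamma α = β) (hd : F.PairwiseDisjoint FinTraj.cylinder)
    {E : Set (MaxTraj D)} (hE : MeasurableSet E) :
    p.P α (⋃ v ∈ F, v.followedBy E) = p.P α (⋃ v ∈ F, v.cylinder) * p.P β E := by
  rw [measure_biUnion F.to_countable hd fun v _ => v.measurableSet_cylinder,
    measure_biUnion F.to_countable (hd.mono fun v => v.followedBy_subset E)
      fun v _ => v.measurableSet_followedBy hE, ← ENNReal.tsum_mul_right]
  exact tsum_congr fun v => hp.measure_followedBy (hF v v.2) hE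

end ProbProcess

/-! ### Existence of long prefixes -/

section Cuts

open Classical

theorem getElem?_inducedList_trunc (A : Set V) {B : Set V} (x : ℕ → B) (m i : ℕ)
    (h : i < Nat.count (fun j => (x j : V) ∈ A) m) :
    (inducedList A (trunc x m))[i]? = inducedSeq A x i := by
  induction m with
  | zero => simp at h
  | succ m ih =>
    rw [trunc_succ, inducedList_append]
    by_cases hi : i < Nat.count (fun j => (x j : V) ∈ A) m
    · rw [List.getElem?_append_left (by rwa [count_trunc]), ih hi]
    · have hm : (x m : V) ∈ A := by
        by_contra hm
        rw [Nat.count_succ, if_neg hm] at h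
        exact hi h
      have hi' : i = Nat.count (fun j => (x j : V) ∈ A) m := by
        rw [Nat.count_succ, if_pos hm] at h
        omega
      rw [List.getElem?_append_right (by rw [count_trunc]; omega), count_trunc, ← hi', inducedSeq,
        if_pos ⟨m + 1, h⟩, hi', Nat.nth_count (p := fun j => (x j : V) ∈ A) hm]
      simp [inducedList, hm]

/-- Both prefixes induce the initial segment of the common `Q`-sequence that has the given number of
terms. -/
theorem MaxTraj.isCut_of_count_eq (ω : MaxTraj D) {m n : ℕ}
    (h : Nat.count (fun j => (ω.fst j : V) ∈ D.Q) m = Nat.count (fun j => (ω.snd j : V) ∈ D.Q) n) :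
    ω.IsCut (m, n) := by
  unfold MaxTraj.IsCut
  refine List.ext_getElem? fun i => ?_
  by_cases hi : i < Nat.count (fun j => (ω.fst j : V) ∈ D.Q) m
  · rw [getElem?_inducedList_trunc _ _ _ _ hi, getElem?_inducedList_trunc _ _ _ _ (h ▸ hi), ω.sync]
  · rw [List.getElem?_eq_none (by rw [count_trunc]; exact not_lt.1 hi),
      List.getElem?_eq_none (by rw [count_trunc, ← h]; exact not_lt.1 hi)]

/-- The sequence that lags behind catches up: it has as many terms in `A` as the other one, and its
count grows by steps of at most one, so the first time it reaches the target it equals it. -/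
theorem exists_count_eq_of_inducedSeq_eq (A : Set V) {B C : Set V} (x : ℕ → B) (y : ℕ → C)
    (h : inducedSeq A x = inducedSeq A y) (n : ℕ)
    (hle : Nat.count (fun j => (x j : V) ∈ A) n ≤ Nat.count (fun j => (y j : V) ∈ A) n) :
    ∃ m, n ≤ m ∧ Nat.count (fun j => (x j : V) ∈ A) m = Nat.count (fun j => (y j : V) ∈ A) n := by
  rcases hle.eq_or_lt with heq | hlt
  · exact ⟨n, le_rfl, heq⟩
  set c := Nat.count (fun j => (y j : V) ∈ A) n with hc
  have hex : ∃ k, c ≤ Nat.count (fun j => (x j : V) ∈ A) k := by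
    -- Here `c > 0` by `hlt`, so term `c - 1` of the induced sequence exists.
    have hy : inducedSeq A y (c - 1) ≠ none := by
      rw [inducedSeq, if_pos ⟨n, by omega⟩]
      simp
    rw [← h, inducedSeq] at hy
    by_contra hcon
    push Not at hcon
    refine hy (if_neg ?_)
    rintro ⟨k, hk⟩
    have := hcon k
    omega
  have hfind := Nat.find_spec hex
  have hpos : Nat.find hex ≠ 0 := by
    intro h0
    rw [h0, Nat.count_zero] at hfind
    omega
  obtain ⟨m, hm⟩ := Nat.exists_eq_succ_of_ne_zero hpos
  have hmin := Nat.find_min hex (m := m) (by omega)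
  have heq : Nat.count (fun j => (x j : V) ∈ A) (m + 1) = c := by
    rw [hm] at hfind
    rw [Nat.succ_eq_add_one, Nat.count_succ] at hfind
    rw [Nat.count_succ]
    split_ifs at * <;> omega
  refine ⟨m + 1, ?_, heq⟩
  by_contra hcon
  have := Nat.count_monotone (fun j => (x j : V) ∈ A) (show m + 1 ≤ n by omega)
  omega

/-- Maximal trajectories have arbitrarily long prefixes. -/
theorem MaxTraj.exists_isPrefix (ω : MaxTraj D) (n : ℕ) :
    ∃ v : FinTraj D, v.IsPrefix ω ∧ (n, n) ≤ v.length := by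
  have key : ∃ t, (n, n) ≤ t ∧ ω.IsCut t := by
    rcases le_total (Nat.count (fun j => (ω.fst j : V) ∈ D.Q) n)
      (Nat.count (fun j => (ω.snd j : V) ∈ D.Q) n) with h | h
    · obtain ⟨m, hm, he⟩ := exists_count_eq_of_inducedSeq_eq D.Q ω.fst ω.snd ω.sync n h
      exact ⟨(m, n), ⟨hm, le_rfl⟩, ω.isCut_of_count_eq he⟩
    · obtain ⟨m, hm, he⟩ := exists_count_eq_of_inducedSeq_eq D.Q ω.snd ω.fst ω.sync.symm n h
      exact ⟨(n, m), ⟨le_rfl, hm⟩, ω.isCut_of_count_eq he.symm⟩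
  obtain ⟨t, ht, hc⟩ := key
  refine ⟨ω.take t hc, ?_, ?_⟩
  · simp [FinTraj.IsPrefix, MaxTraj.take, trunc_length]
  · simpa [FinTraj.length, MaxTraj.take, trunc_length] using ht

end Cuts

/-! ### First returns -/

/-- Trajectories ending in `α`, of length at least `(1,1)`, and minimal for these properties. -/
def firstReturns (α : GlobalState D) : Set (FinTraj D) :=
  {v | Minimal (fun u => u.gamma α = α ∧ (1, 1) ≤ u.length) v}

/-- Anything below a prefix of `ω` is again a prefix of `ω`, so minimality can be tested without
reference to `ω`. The first return is thus described by one countable set of trajectories. -/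
theorem isLeast_returnSet_iff {α : GlobalState D} {ω : MaxTraj D} {v : FinTraj D} :
    IsLeast (returnSet α ω) v ↔ v ∈ firstReturns α ∧ v.IsPrefix ω := by
  have h1 : ∀ v, IsLeast (returnSet α ω) v → v ∈ firstReturns α ∧ v.IsPrefix ω := fun v h =>
    ⟨⟨h.1.2, fun u hu huv => h.2 ⟨h.1.1.of_le huv, hu⟩⟩, h.1.1⟩
  refine ⟨h1 v, fun h => ?_⟩
  have hv : v ∈ returnSet α ω := ⟨h.2, h.1.1⟩
  obtain ⟨w, hw⟩ := exists_isLeast_returnSet α ω ⟨v, hv⟩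
  have hmin : Minimal (fun u => u.gamma α = α ∧ (1, 1) ≤ u.length) v := h.1
  rwa [← hmin.eq_of_le hw.1.2 (hw.2 hv)]

theorem pairwiseDisjoint_firstReturns (α : GlobalState D) :
    (firstReturns α).PairwiseDisjoint FinTraj.cylinder := by
  intro v hv w hw hne
  refine Set.disjoint_left.2 fun ω h h' => hne ?_
  exact (isLeast_returnSet_iff.2 ⟨hv, h⟩).unique (isLeast_returnSet_iff.2 ⟨hw, h'⟩)

theorem exists_firstReturn {α : GlobalState D} {ω : MaxTraj D} {v : FinTraj D}
    (hv : v.IsPrefix ω) (hα : v.gamma α = α) (h1 : (1, 1) ≤ v.length) :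
    ∃ w ∈ firstReturns α, w.IsPrefix ω := by
  obtain ⟨w, hw⟩ := exists_isLeast_returnSet α ω ⟨v, hv, hα, h1⟩
  exact ⟨w, isLeast_returnSet_iff.1 hw⟩

theorem returnTime_eq {α : GlobalState D} {ω : MaxTraj D} {v : FinTraj D}
    (hv : v ∈ firstReturns α) (h : v.IsPrefix ω) : returnTime α ω = (v.length : ℕ × ℕ) := by
  have hl := isLeast_returnSet_iff.2 ⟨hv, h⟩
  have hne : (returnSet α ω).Nonempty := ⟨v, hl.1⟩
  refine (dif_pos hne).trans ?_
  rw [(exists_isLeast_returnSet α ω hne).choose_spec.unique hl]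

theorem returnTime_ne_top_iff {α : GlobalState D} {ω : MaxTraj D} :
    returnTime α ω ≠ ⊤ ↔ ∃ v ∈ firstReturns α, v.IsPrefix ω := by
  constructor
  · intro h
    by_contra hcon
    refine h (dif_neg ?_)
    rintro ⟨v, hv⟩
    exact hcon (exists_firstReturn hv.1 hv.2.1 hv.2.2)
  · rintro ⟨v, hv, h⟩
    rw [returnTime_eq hv h]
    exact WithTop.coe_ne_top

theorem setOf_returnTime_ne_top (α : GlobalState D) :
    {ω | returnTime α ω ≠ ⊤} = ⋃ v ∈ firstReturns α, v.cylinder := by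
  ext ω
  simpa [FinTraj.cylinder] using returnTime_ne_top_iff

/-! ### Shifts by composed random times -/

namespace RandomTime

theorem shift_eq_some {T : RandomTime D} {ω : MaxTraj D} {t : ℕ × ℕ} (h : T ω = t) :
    T.shift ω = some (ω.drop t (T.isCut ω t h)) := by
  have hne : T ω ≠ ⊤ := h ▸ WithTop.coe_ne_top
  have hu : (T ω).untop hne = t := by simp [h]
  rw [shift, dif_pos hne]
  simp only [hu]

theorem shift_ne_none_iff {T : RandomTime D} {ω : MaxTraj D} : T.shift ω ≠ none ↔ T ω ≠ ⊤ := by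
  unfold shift
  split_ifs with h <;> simp_all

theorem stopped_eq_some {T : RandomTime D} {ω : MaxTraj D} {t : ℕ × ℕ} (h : T ω = t) :
    T.stopped ω = some (ω.take t (T.isCut ω t h)) := by
  have hne : T ω ≠ ⊤ := h ▸ WithTop.coe_ne_top
  have hu : (T ω).untop hne = t := by simp [h]
  rw [stopped, dif_pos hne]
  simp only [hu]

theorem shift_zero (ω : MaxTraj D) : (zero : RandomTime D).shift ω = some ω := by
  rw [shift_eq_some (T := zero) (t := 0) rfl]
  congr 1
  ext1 <;> simp [MaxTraj.drop]

theorem shift_add (S T : RandomTime D) (ω : MaxTraj D) :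
    (S.add T).shift ω = (S.shift ω).bind T.shift := by
  by_cases hS : S ω = ⊤
  · have h1 : S.add T ω = ⊤ := dif_neg (not_not.2 hS)
    have h2 : S.shift ω = none := by simpa [hS] using (shift_ne_none_iff (T := S) (ω := ω)).not
    have h3 : (S.add T).shift ω = none := by
      simpa [h1] using (shift_ne_none_iff (T := S.add T) (ω := ω)).not
    rw [h2, h3]
    rfl
  obtain ⟨t, ht⟩ := WithTop.ne_top_iff_exists.1 hS
  have hu : (S ω).untop hS = t := by simp [← ht]
  have hadd : S.add T ω = t + T (ω.drop t (S.isCut ω t ht.symm)) := by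
    refine (dif_pos hS).trans ?_
    simp only [hu]
    exact congrArg (· + _) ht.symm
  rw [shift_eq_some ht.symm, Option.bind_some]
  by_cases hT : T (ω.drop t (S.isCut ω t ht.symm)) = ⊤
  · rw [hT, WithTop.add_top] at hadd
    rw [show T.shift _ = none by
        simpa [hT] using (shift_ne_none_iff (T := T) (ω := ω.drop t (S.isCut ω t ht.symm))).not]
    simpa [hadd] using (shift_ne_none_iff (T := S.add T) (ω := ω)).not
  · obtain ⟨u, hu⟩ := WithTop.ne_top_iff_exists.1 hT
    rw [← hu, ← WithTop.coe_add] at hadd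
    rw [shift_eq_some hadd, shift_eq_some hu.symm]
    congr 1
    ext1 <;> simp [MaxTraj.drop, add_assoc]

/-- `iter` adds the new return at the end; this form splits off the first return instead, where the
Markov property applies. -/
theorem shift_iter_succ (T : RandomTime D) (n : ℕ) (ω : MaxTraj D) :
    (T.iter (n + 1)).shift ω = (T.shift ω).bind (T.iter n).shift := by
  induction n with
  | zero =>
    have h : (zero : RandomTime D).shift = some := funext shift_zero
    change (zero.add T).shift ω = (T.shift ω).bind zero.shift
    rw [shift_add, h, Option.bind_some, Option.bind_fun_some]
  | succ n ih =>
    rw [iter, shift_add, ih, Option.bind_assoc]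
    congr 1
    funext ω'
    rw [← shift_add, ← iter]

end RandomTime

theorem shift_returnTime {α : GlobalState D} {ω : MaxTraj D} {v : FinTraj D}
    (hv : v ∈ firstReturns α) (h : v.IsPrefix ω) :
    (returnTime α).shift ω = some (ω.after v) := by
  rw [RandomTime.shift_eq_some (returnTime_eq hv h), h.after_eq]

theorem stopped_returnTime {α : GlobalState D} {ω : MaxTraj D} {v : FinTraj D}
    (hv : v ∈ firstReturns α) (h : v.IsPrefix ω) :
    (returnTime α).stopped ω = some v := by
  rw [RandomTime.stopped_eq_some (returnTime_eq hv h), h.take_eq]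

/-! ### Infinitely many visits -/

/-- The maximal trajectories with a prefix of length at least `(n,n)` leading from `α` to `β`. -/
def visitsAfter (α β : GlobalState D) (n : ℕ) : Set (MaxTraj D) :=
  {ω | ∃ v : FinTraj D, v.IsPrefix ω ∧ v.gamma α = β ∧ (n, n) ≤ v.length}

theorem measurableSet_visitsAfter (α β : GlobalState D) (n : ℕ) :
    MeasurableSet (visitsAfter α β n) := by
  have : visitsAfter α β n =
      ⋃ v ∈ {v : FinTraj D | v.gamma α = β ∧ (n, n) ≤ v.length}, v.cylinder := by
    ext ω
    simp [visitsAfter, FinTraj.cylinder, and_comm]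
  rw [this]
  exact MeasurableSet.biUnion (Set.to_countable _) fun v _ => v.measurableSet_cylinder

theorem antitone_visitsAfter (α β : GlobalState D) : Antitone (visitsAfter α β) := by
  rintro m n h ω ⟨v, hv, hβ, hl⟩
  exact ⟨v, hv, hβ, le_trans ⟨h, h⟩ hl⟩

/-- The maximal trajectories that pass through `β` infinitely often. -/
def visitsInfinitelyOften (β : GlobalState D) : Set (MaxTraj D) :=
  ⋂ n, visitsAfter β β n

theorem measurableSet_visitsInfinitelyOften (β : GlobalState D) :
    MeasurableSet (visitsInfinitelyOften β) :=
  MeasurableSet.iInter fun n => measurableSet_visitsAfter β β n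

theorem visitsAfter_congr (α α' β : GlobalState D) {n : ℕ} (hn : 1 ≤ n) :
    visitsAfter α β n = visitsAfter α' β n := by
  ext ω
  refine exists_congr fun v => and_congr_right fun _ => and_congr_left fun h => ?_
  rw [FinTraj.gamma_eq_gamma (le_trans ⟨hn, hn⟩ h) α α']

/-- Level `0` is left out because `gamma` depends on the initial state when a component is empty;
from level `1` on the initial state is immaterial. -/
theorem iInter_visitsAfter (α β : GlobalState D) :
    ⋂ n, visitsAfter α β (n + 1) = visitsInfinitelyOften β := by
  rw [visitsInfinitelyOften]
  refine Set.Subset.antisymm (Set.subset_iInter fun n => ?_) (Set.subset_iInter fun n => ?_)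
  · refine (Set.iInter_subset _ n).trans ?_
    rw [visitsAfter_congr α β β n.succ_pos]
    exact antitone_visitsAfter β β n.le_succ
  · rw [visitsAfter_congr α β β n.succ_pos]
    exact Set.iInter_subset _ (n + 1)

/-- Long prefixes of the remainder extend `s`, and every prefix of `ω` that is long enough factors
through `s`. -/
theorem after_mem_visitsInfinitelyOften_iff {β : GlobalState D} {s : FinTraj D} {ω : MaxTraj D}
    (hs : s.IsPrefix ω) :
    ω.after s ∈ visitsInfinitelyOften β ↔ ω ∈ visitsInfinitelyOften β := by
  constructor
  · intro h
    -- The initial state of the remainder is taken to be `s.gamma β`, as `gamma_append` requires.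
    rw [← iInter_visitsAfter (s.gamma β) β] at h
    rw [← iInter_visitsAfter β β]
    refine Set.mem_iInter.2 fun n => ?_
    obtain ⟨v, hv, hβ, hl⟩ := Set.mem_iInter.1 h n
    refine ⟨s.append v, (s.isPrefix_append_iff v ω).2 ⟨hs, hv⟩, ?_, ?_⟩
    · rw [FinTraj.gamma_append, hβ]
    · rw [FinTraj.length_append]
      exact hl.trans le_add_self
  · intro h
    rw [← iInter_visitsAfter (s.gamma β) β]
    refine Set.mem_iInter.2 fun n => ?_
    -- This level exceeds each component of `s.length` by at least `n + 1`, which is what remains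
    -- once `s` is removed.
    obtain ⟨v, hv, hβ, hl⟩ := Set.mem_iInter.1 h (s.length.1 + s.length.2 + n + 1)
    have hsv : s.length ≤ v.length :=
      le_trans ⟨by simp only; omega, by simp only; omega⟩ hl
    obtain ⟨u, rfl⟩ := hs.exists_append hv hsv
    refine ⟨u, ((s.isPrefix_append_iff u ω).1 hv).2, ?_, ?_⟩
    · rw [← FinTraj.gamma_append, hβ]
    · rw [FinTraj.length_append] at hl
      obtain ⟨h1, h2⟩ := hl
      simp only [Prod.fst_add, Prod.snd_add] at h1 h2
      exact ⟨by simp only; omega, by simp only; omega⟩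

theorem shift_iter_returnTime_ne_none {α : GlobalState D} (n : ℕ) {ω : MaxTraj D}
    (h : ω ∈ visitsInfinitelyOften α) : ((returnTime α).iter n).shift ω ≠ none := by
  induction n generalizing ω with
  | zero => rw [RandomTime.iter, RandomTime.shift_zero]; simp
  | succ n ih =>
    obtain ⟨v, hv, hα, hl⟩ := Set.mem_iInter.1 h 1
    obtain ⟨w, hw, hwω⟩ := exists_firstReturn hv hα hl
    rw [RandomTime.shift_iter_succ, shift_returnTime hw hwω]
    exact ih ((after_mem_visitsInfinitelyOften_iff hwω).2 h)

theorem mem_visitsAfter_of_shift_iter {α : GlobalState D} (n : ℕ) {ω : MaxTraj D}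
    (h : ((returnTime α).iter n).shift ω ≠ none) : ω ∈ visitsAfter α α n := by
  induction n generalizing ω with
  | zero => exact ⟨FinTraj.empty, FinTraj.isPrefix_empty ω, rfl, le_rfl⟩
  | succ n ih =>
    rw [RandomTime.shift_iter_succ] at h
    have hR : (returnTime α).shift ω ≠ none := fun h0 => h (by rw [h0]; rfl)
    obtain ⟨v, hv, hvω⟩ := returnTime_ne_top_iff.1 (RandomTime.shift_ne_none_iff.1 hR)
    rw [shift_returnTime hv hvω] at h
    obtain ⟨u, hu, hα, hl⟩ := ih h
    refine ⟨v.append u, (v.isPrefix_append_iff u ω).2 ⟨hvω, hu⟩, ?_, ?_⟩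
    · rw [FinTraj.gamma_append, hv.1.1, hα]
    · rw [FinTraj.length_append, add_comm v.length]
      exact add_le_add hl hv.1.2

/-- Each return adds at least `(1,1)` to the length, so `n` returns give a prefix of length at least
`(n,n)`. Conversely, infinitely many visits provide a first return, and the remainder still has
infinitely many visits. -/
theorem returnsInfinitelyOften_eq (α : GlobalState D) :
    returnsInfinitelyOften α = visitsInfinitelyOften α := by
  ext ω
  constructor
  · intro h
    rw [← iInter_visitsAfter α α]
    exact Set.mem_iInter.2 fun n =>
      mem_visitsAfter_of_shift_iter _ (RandomTime.shift_ne_none_iff.2 (h _ n.succ_pos))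
  · exact fun h n _ => RandomTime.shift_ne_none_iff.1 (shift_iter_returnTime_ne_none n h)

/-- Every maximal trajectory passes infinitely often through some global state. -/
theorem iUnion_visitsInfinitelyOften (D : DistributedSystem V) :
    ⋃ β : GlobalState D, visitsInfinitelyOften β = Set.univ := by
  have := D.finite₁.to_subtype
  have := D.finite₂.to_subtype
  refine Set.eq_univ_of_forall fun ω => Set.mem_iUnion.2 ?_
  choose v hv hl using ω.exists_isPrefix
  -- An arbitrary initial state, needed only to form `gamma`.
  let α : GlobalState D := (ω.fst 0, ω.snd 0)
  obtain ⟨β, hβ⟩ := Finite.exists_infinite_fiber fun n => (v n).gamma α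
  rw [Set.infinite_coe_iff] at hβ
  refine ⟨β, ?_⟩
  rw [← iInter_visitsAfter α β]
  refine Set.mem_iInter.2 fun n => ?_
  obtain ⟨m, hm, hnm⟩ := hβ.exists_gt n
  exact ⟨v m, hv m, hm, le_trans (Prod.mk_le_mk.2 ⟨hnm, hnm⟩) (hl m)⟩

/-! ### Measurability of the returning trajectories -/

theorem returningTraj_zero (α : GlobalState D) (ω : MaxTraj D) :
    returningTraj α 0 ω = (returnTime α).stopped ω := by
  rw [returningTraj, RandomTime.iter, RandomTime.shift_zero, Option.bind_some]

theorem returningTraj_succ (α : GlobalState D) (n : ℕ) (ω : MaxTraj D) :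
    returningTraj α (n + 1) ω = ((returnTime α).shift ω).bind (returningTraj α n) := by
  rw [returningTraj, RandomTime.shift_iter_succ, Option.bind_assoc]
  rfl

theorem stopped_returnTime_eq_some_iff {α : GlobalState D} {ω : MaxTraj D} {v : FinTraj D} :
    (returnTime α).stopped ω = some v ↔ v ∈ firstReturns α ∧ v.IsPrefix ω := by
  refine ⟨fun h => ?_, fun h => stopped_returnTime h.1 h.2⟩
  have hne : returnTime α ω ≠ ⊤ := by
    intro htop
    rw [RandomTime.stopped, dif_neg (not_not.2 htop)] at h
    cases h
  obtain ⟨w, hw, hwω⟩ := returnTime_ne_top_iff.1 hne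
  rw [stopped_returnTime hw hwω] at h
  cases h
  exact ⟨hw, hwω⟩

theorem measurable_option_of_some {Ω : Type*} [MeasurableSpace Ω] {f : Ω → Option (FinTraj D)}
    (h : ∀ v, MeasurableSet {ω | f ω = some v}) : Measurable f := by
  refine measurable_to_countable' fun x => ?_
  cases x with
  | some v => exact h v
  | none =>
    have : f ⁻¹' {none} = (⋃ v, {ω | f ω = some v})ᶜ := by
      ext ω
      simp [Option.eq_none_iff_forall_ne_some]
    rw [this]
    exact (MeasurableSet.iUnion h).compl

theorem measurable_returningTraj (α : GlobalState D) (n : ℕ) :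
    Measurable (returningTraj α n) := by
  induction n with
  | zero =>
    refine measurable_option_of_some fun v => ?_
    simp_rw [returningTraj_zero, stopped_returnTime_eq_some_iff]
    exact (MeasurableSet.const _).inter v.measurableSet_cylinder
  | succ n ih =>
    refine measurable_option_of_some fun x => ?_
    have : {ω | returningTraj α (n + 1) ω = some x} =
        ⋃ v ∈ firstReturns α, v.followedBy (returningTraj α n ⁻¹' {some x}) := by
      ext ω
      simp only [Set.mem_ofPred_eq, returningTraj_succ, Set.mem_iUnion, exists_prop]
      constructor
      · intro h
        have hR : (returnTime α).shift ω ≠ none := fun h0 => by rw [h0] at h; cases h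
        obtain ⟨v, hv, hvω⟩ := returnTime_ne_top_iff.1 (RandomTime.shift_ne_none_iff.1 hR)
        rw [shift_returnTime hv hvω] at h
        exact ⟨v, hv, hvω, h⟩
      · rintro ⟨v, hv, hvω, h⟩
        rw [shift_returnTime hv hvω]
        exact h
    rw [this]
    exact MeasurableSet.biUnion (Set.to_countable _) fun v _ =>
      v.measurableSet_followedBy (ih (MeasurableSet.singleton _))

/-! ### Recurrence and transience -/

namespace ProbProcess

variable {p : ProbProcess D}

/-- Decomposition at the first passage through `β`: by invariance under removal of a prefix, what
follows must visit `β` infinitely often. -/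
theorem IsMarkov.measure_visitsInfinitelyOften (hp : p.IsMarkov) {α β : p.X₀} :
    p.P α (visitsInfinitelyOften β) = p.P α (⋃ v ∈ firstReturns (β : GlobalState D), v.cylinder) *
      p.P β (visitsInfinitelyOften β) := by
  rw [← hp.measure_biUnion_followedBy (fun v hv => ?_) (pairwiseDisjoint_firstReturns _)
    (measurableSet_visitsInfinitelyOften _)]
  · congr 1
    ext ω
    simp only [Set.mem_iUnion, exists_prop]
    constructor
    · intro h
      obtain ⟨v, hv, hβ, hl⟩ := Set.mem_iInter.1 h 1
      obtain ⟨w, hw, hwω⟩ := exists_firstReturn hv hβ hl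
      exact ⟨w, hw, hwω, (after_mem_visitsInfinitelyOften_iff hwω).2 h⟩
    · rintro ⟨w, hw, hwω, h⟩
      exact (after_mem_visitsInfinitelyOften_iff hwω).1 h
  · rw [FinTraj.gamma_eq_gamma hv.1.2 α β, hv.1.1]

/-- If the process returns almost surely to `α`, it passes infinitely often, with positive
probability, through every state reachable from `α`. -/
theorem IsMarkov.le_measure_visitsInfinitelyOften (hp : p.IsMarkov) {α : p.X₀}
    {β : GlobalState D} (hα : p.P α {ω | returnTime (α : GlobalState D) ω ≠ ⊤} = 1)
    {s : FinTraj D} (hs : s.gamma α = β) :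
    p.P α s.cylinder ≤ p.P α (visitsInfinitelyOften β) := by
  have := p.isProbabilityMeasure α
  -- An almost sure first return restarts the process at `α`; put in front, it lengthens the prefix
  -- by at least `(1,1)` without loss of probability.
  have key : ∀ n, p.P α s.cylinder ≤ p.P α (visitsAfter α β n) := by
    intro n
    induction n with
    | zero => exact measure_mono fun ω h => ⟨s, h, hs, bot_le⟩
    | succ n ih =>
      rw [setOf_returnTime_ne_top] at hα
      calc p.P α s.cylinder ≤ p.P α (visitsAfter α β n) := ih
        _ = p.P α (⋃ v ∈ firstReturns (α : GlobalState D),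
              v.followedBy (visitsAfter α β n)) := by
            rw [hp.measure_biUnion_followedBy (fun v hv => hv.1.1)
              (pairwiseDisjoint_firstReturns _) (measurableSet_visitsAfter _ _ _), hα, one_mul]
        _ ≤ _ := by
            refine measure_mono (Set.iUnion₂_subset ?_)
            rintro v hv ω ⟨hvω, u, hu, hβ, hl⟩
            refine ⟨v.append u, (v.isPrefix_append_iff u ω).2 ⟨hvω, hu⟩, ?_, ?_⟩
            · rw [FinTraj.gamma_append, hv.1.1, hβ]
            · rw [FinTraj.length_append, add_comm v.length]
              exact add_le_add hl hv.1.2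
  have hanti : Antitone fun n => visitsAfter (α : GlobalState D) β (n + 1) :=
    fun m n h => antitone_visitsAfter _ _ (Nat.succ_le_succ h)
  rw [← iInter_visitsAfter (α : GlobalState D) β, hanti.measure_iInter
    (fun n => (measurableSet_visitsAfter _ _ _).nullMeasurableSet) ⟨0, measure_ne_top _ _⟩]
  exact le_iInf fun n => key (n + 1)

theorem IsMarkov.measure_eq_one_of_returnTime (hp : p.IsMarkov) {α : p.X₀}
    (hα : p.P α {ω | returnTime (α : GlobalState D) ω ≠ ⊤} = 1) :
    p.P α (visitsInfinitelyOften α) = 1 := by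
  have := p.isProbabilityMeasure α
  refine le_antisymm prob_le_one ?_
  have := hp.le_measure_visitsInfinitelyOften hα (s := FinTraj.empty) rfl
  rwa [FinTraj.cylinder_empty, measure_univ] at this

/-- A finite `x` with `x = r * x` and `r < 1` is zero. -/
theorem IsMarkov.measure_eq_zero_of_returnTime (hp : p.IsMarkov) {α : p.X₀}
    (hα : p.P α {ω | returnTime (α : GlobalState D) ω ≠ ⊤} < 1) :
    p.P α (visitsInfinitelyOften α) = 0 := by
  have := p.isProbabilityMeasure α
  have h := hp.measure_visitsInfinitelyOften (α := α) (β := α)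
  rw [← setOf_returnTime_ne_top] at h
  by_contra h0
  refine h.not_gt ?_
  calc _ < 1 * p.P α (visitsInfinitelyOften α) :=
        (ENNReal.mul_lt_mul_iff_left h0 (measure_ne_top _ _)).2 hα
    _ = _ := one_mul _

/-- The second factor in the first-passage decomposition is nonzero, which excludes a return
probability less than `1`. -/
theorem IsMarkov.recurrent_of_pos (hp : p.IsMarkov) {α β : p.X₀}
    (h : p.P α (visitsInfinitelyOften β) ≠ 0) : p.Recurrent β := by
  have := p.isProbabilityMeasure β
  rw [hp.measure_visitsInfinitelyOften] at h
  rw [Recurrent, returnsInfinitelyOften_eq]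
  refine hp.measure_eq_one_of_returnTime (le_antisymm prob_le_one ?_)
  by_contra hlt
  exact right_ne_zero_of_mul h (hp.measure_eq_zero_of_returnTime (not_le.1 hlt))

theorem reachable_of_visitsInfinitelyOften_pos {α : p.X₀} {β : GlobalState D}
    (h : p.P α (visitsInfinitelyOften β) ≠ 0) : ReachableWrt (p.P α) α β := by
  by_contra hcon
  simp only [ReachableWrt, not_exists, not_and'] at hcon
  refine h (measure_mono_null (t := ⋃ v ∈ {v : FinTraj D | v.gamma α = β}, v.cylinder) ?_ ?_)
  · intro ω hω
    rw [← iInter_visitsAfter (α : GlobalState D)] at hω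
    obtain ⟨v, hv, hβ, -⟩ := Set.mem_iInter.1 hω 0
    exact Set.mem_biUnion hβ hv
  · exact (measure_biUnion_null_iff (Set.to_countable _)).2 fun v hv => by
      simpa using hcon v hv

theorem IsMarkov.exists_recurrent (hp : p.IsMarkov) (hne : p.X₀.Nonempty) :
    ∃ β : p.X₀, p.Recurrent β := by
  obtain ⟨α, hα⟩ := hne
  lift α to p.X₀ using hα
  have := p.isProbabilityMeasure α
  have := D.finite₁.to_subtype
  have := D.finite₂.to_subtype
  have hpos : ∃ β : GlobalState D, p.P α (visitsInfinitelyOften β) ≠ 0 := by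
    by_contra! hcon
    have h := measure_iUnion_null hcon
    rw [iUnion_visitsInfinitelyOften, measure_univ] at h
    exact one_ne_zero h
  obtain ⟨β, hβ⟩ := hpos
  -- Only reachability places `β` in `X₀`, so that `P β` makes sense.
  lift β to p.X₀ using p.mem_of_reachable α β (reachable_of_visitsInfinitelyOften_pos hβ)
  exact ⟨β, hp.recurrent_of_pos hβ⟩

theorem IsMarkov.recurrent_iff (hp : p.IsMarkov) (α : p.X₀) :
    p.Recurrent α ↔ p.P α {ω | returnTime (α : GlobalState D) ω ≠ ⊤} = 1 := by
  have := p.isProbabilityMeasure α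
  rw [Recurrent, returnsInfinitelyOften_eq]
  refine ⟨fun h => le_antisymm prob_le_one ?_, hp.measure_eq_one_of_returnTime⟩
  by_contra hlt
  rw [hp.measure_eq_zero_of_returnTime (not_le.1 hlt)] at h
  exact zero_ne_one h

theorem IsMarkov.transient_iff (hp : p.IsMarkov) (α : p.X₀) :
    p.Transient α ↔ p.P α {ω | returnTime (α : GlobalState D) ω ≠ ⊤} < 1 := by
  have := p.isProbabilityMeasure α
  rw [Transient, returnsInfinitelyOften_eq]
  refine ⟨fun h => lt_of_le_of_ne prob_le_one fun h1 => ?_, hp.measure_eq_zero_of_returnTime⟩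
  rw [hp.measure_eq_one_of_returnTime h1] at h
  exact one_ne_zero h

theorem IsMarkov.recurrent_of_reachable (hp : p.IsMarkov) {α β : p.X₀} (hα : p.Recurrent α)
    (h : p.Reachable α β) : p.Recurrent β ∧ p.Reachable β α := by
  have := p.isProbabilityMeasure α
  obtain ⟨s, hs, hβ⟩ := h
  refine ⟨?_, reachable_of_visitsInfinitelyOften_pos ?_⟩
  · exact hp.recurrent_of_pos (α := α) (ne_of_gt
      (hs.trans_le (hp.le_measure_visitsInfinitelyOften ((hp.recurrent_iff α).1 hα) hβ)))
  -- Under `P α` almost every trajectory starting with `s` visits `α` infinitely often; were this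
  -- null under `P β`, the Markov property after `s` would force the cylinder of `s` to be null.
  · have h1 := hp.measure_followedBy hβ (measurableSet_visitsInfinitelyOften (α : GlobalState D))
    intro h0
    rw [h0, mul_zero] at h1
    have h2 : s.cylinder ∩ visitsInfinitelyOften (α : GlobalState D) ⊆
        s.followedBy (visitsInfinitelyOften α) :=
      fun ω hω => ⟨hω.1, (after_mem_visitsInfinitelyOften_iff hω.1).2 hω.2⟩
    have h3 : p.P α (visitsInfinitelyOften (α : GlobalState D))ᶜ = 0 := by
      rw [Recurrent, returnsInfinitelyOften_eq] at hα
      rwa [prob_compl_eq_zero_iff (measurableSet_visitsInfinitelyOften _)]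
    rw [← measure_inter_conull h3, measure_mono_null h2 h1] at hs
    exact lt_irrefl _ hs

/-! ### Independence of the returning trajectories -/

theorem ae_returningTraj_ne_none (α : p.X₀) (hα : p.Recurrent α) :
    ∀ᵐ ω ∂(p.P α), ∀ n, returningTraj (α : GlobalState D) n ω ≠ none := by
  have := p.isProbabilityMeasure α
  have hmem : ∀ᵐ ω ∂(p.P α), ω ∈ visitsInfinitelyOften (α : GlobalState D) := by
    rw [Recurrent, returnsInfinitelyOften_eq] at hα
    exact (prob_compl_eq_zero_iff (measurableSet_visitsInfinitelyOften _)).2 hα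
  filter_upwards [hmem] with ω hω n
  induction n generalizing ω with
  | zero =>
    obtain ⟨v, hv, hβ, hl⟩ := Set.mem_iInter.1 hω 1
    obtain ⟨w, hw, hwω⟩ := exists_firstReturn hv hβ hl
    rw [returningTraj_zero, stopped_returnTime hw hwω]
    simp
  | succ n ih =>
    obtain ⟨v, hv, hβ, hl⟩ := Set.mem_iInter.1 hω 1
    obtain ⟨w, hw, hwω⟩ := exists_firstReturn hv hβ hl
    rw [returningTraj_succ, shift_returnTime hw hwω]
    exact ih _ ((after_mem_visitsInfinitelyOften_iff hwω).2 hω)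

/-- The joint law of the first `n` returning trajectories is a product. -/
theorem IsMarkov.measure_returningTraj_mem (hp : p.IsMarkov) (α : p.X₀) (hα : p.Recurrent α)
    (n : ℕ) (A : ℕ → Set (Option (FinTraj D))) :
    p.P α {ω | ∀ i < n, returningTraj (α : GlobalState D) i ω ∈ A i} =
      ∏ i ∈ Finset.range n, p.P α (returningTraj (α : GlobalState D) 0 ⁻¹' A i) := by
  have := p.isProbabilityMeasure α
  induction n generalizing A with
  | zero => simp
  | succ n ih =>
    -- The conditions on the later returning trajectories, read on the remainder after the first
    -- return: indices drop by one.
    set E := {ω | ∀ i < n, returningTraj (α : GlobalState D) i ω ∈ A (i + 1)} with hE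
    have hEm : MeasurableSet E := by
      have : E = ⋂ i, ⋂ _ : i < n, returningTraj (α : GlobalState D) i ⁻¹' A (i + 1) := by
        ext ω
        simp [hE]
      rw [this]
      exact MeasurableSet.iInter fun i => MeasurableSet.iInter fun _ =>
        measurable_returningTraj _ i trivial
    -- Only values `some v` are kept: the value `none` is null by recurrence, even if it belongs to
    -- `A 0`.
    set F : Set (FinTraj D) := {v ∈ firstReturns (α : GlobalState D) | some v ∈ A 0} with hF
    have hFsub : F ⊆ firstReturns (α : GlobalState D) := fun v hv => hv.1
    have hae : ∀ᵐ ω ∂(p.P α), ∃ v ∈ firstReturns (α : GlobalState D), v.IsPrefix ω := by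
      filter_upwards [ae_returningTraj_ne_none α hα] with ω hω
      obtain ⟨v, hv⟩ := Option.ne_none_iff_exists'.1 (hω 0)
      rw [returningTraj_zero, stopped_returnTime_eq_some_iff] at hv
      exact ⟨v, hv⟩
    have hmem : ∀ {v ω}, v ∈ firstReturns (α : GlobalState D) → v.IsPrefix ω →
        ∀ E' : Set (MaxTraj D), (ω ∈ ⋃ w ∈ F, w.followedBy E') ↔
          some v ∈ A 0 ∧ ω.after v ∈ E' := by
      intro v ω hv hvω E'
      simp only [Set.mem_iUnion, exists_prop]
      constructor
      · rintro ⟨w, hw, hwω, h⟩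
        obtain rfl : w = v := (isLeast_returnSet_iff.2 ⟨hw.1, hwω⟩).unique
          (isLeast_returnSet_iff.2 ⟨hv, hvω⟩)
        exact ⟨hw.2, h⟩
      · rintro ⟨hA, h⟩
        exact ⟨v, ⟨hv, hA⟩, hvω, h⟩
    have h1 : p.P α {ω | ∀ i < n + 1, returningTraj (α : GlobalState D) i ω ∈ A i} =
        p.P α (⋃ v ∈ F, v.followedBy E) := by
      refine measure_congr ?_
      filter_upwards [hae] with ω ⟨v, hv, hvω⟩
      refine propext (Iff.trans ?_ (hmem hv hvω E).symm)
      change (∀ i < n + 1, _) ↔ _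
      rw [Nat.forall_lt_succ_left]
      simp only [returningTraj_zero, stopped_returnTime hv hvω, returningTraj_succ,
        shift_returnTime hv hvω, Option.bind_some, hE, Set.mem_ofPred_eq]
    have h2 : p.P α (returningTraj (α : GlobalState D) 0 ⁻¹' A 0) =
        p.P α (⋃ v ∈ F, v.cylinder) := by
      refine measure_congr ?_
      filter_upwards [hae] with ω ⟨v, hv, hvω⟩
      refine propext (Iff.trans ?_ ((hmem hv hvω Set.univ).symm.trans ?_))
      · change returningTraj (α : GlobalState D) 0 ω ∈ A 0 ↔ _
        simp [returningTraj_zero, stopped_returnTime hv hvω]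
      · simp only [FinTraj.followedBy, Set.mem_univ, Set.mem_iUnion]
        change _ ↔ ω ∈ ⋃ v ∈ F, v.cylinder
        simp
    rw [h1, hp.measure_biUnion_followedBy (fun v hv => hv.1.1.1)
      ((pairwiseDisjoint_firstReturns _).subset hFsub) hEm, ← h2, ih fun i => A (i + 1),
      Finset.prod_range_succ', mul_comm]

/-- The product formula with a constraint on the coordinate `n` alone. -/
theorem IsMarkov.map_returningTraj (hp : p.IsMarkov) (α : p.X₀) (hα : p.Recurrent α) (n : ℕ)
    (B : Set (Option (FinTraj D))) :
    p.P α (returningTraj (α : GlobalState D) n ⁻¹' B) =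
      p.P α (returningTraj (α : GlobalState D) 0 ⁻¹' B) := by
  have := p.isProbabilityMeasure α
  have h := hp.measure_returningTraj_mem α hα (n + 1) fun i => if i = n then B else Set.univ
  rw [Finset.prod_range_succ, Finset.prod_eq_one, one_mul, if_pos rfl] at h
  · rw [← h]
    congr 1
    ext ω
    constructor
    · intro hω i _
      by_cases hi : i = n
      · subst hi
        simpa using hω
      · simp [hi]
    · intro hω
      simpa using hω n n.lt_succ_self
  · intro i hi
    rw [if_neg (Finset.mem_range.1 hi).ne, Set.preimage_univ, measure_univ]

theorem IsMarkov.identDistrib_returningTraj (hp : p.IsMarkov) (α : p.X₀) (hα : p.Recurrent α)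
    (m n : ℕ) :
    IdentDistrib (returningTraj (α : GlobalState D) m) (returningTraj (α : GlobalState D) n)
      (p.P α) (p.P α) where
  aemeasurable_fst := (measurable_returningTraj _ m).aemeasurable
  aemeasurable_snd := (measurable_returningTraj _ n).aemeasurable
  map_eq := by
    ext B hB
    rw [Measure.map_apply (measurable_returningTraj _ m) hB,
      Measure.map_apply (measurable_returningTraj _ n) hB, hp.map_returningTraj α hα m,
      hp.map_returningTraj α hα n]

theorem IsMarkov.iIndepFun_returningTraj (hp : p.IsMarkov) (α : p.X₀) (hα : p.Recurrent α) :
    iIndepFun (returningTraj (α : GlobalState D)) (p.P α) := by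
  classical
  have := p.isProbabilityMeasure α
  rw [iIndepFun_iff_measure_inter_preimage_eq_mul]
  intro S A _
  obtain ⟨n, hn⟩ : ∃ n, S ⊆ Finset.range n := S.exists_nat_subset_range
  -- Indices below `n` outside `S` are left unconstrained and contribute factors `1`.
  have h := hp.measure_returningTraj_mem α hα n fun i => if i ∈ S then A i else Set.univ
  convert h using 1
  · congr 1
    ext ω
    simp only [Set.mem_iInter, Set.mem_preimage, Set.mem_ofPred_eq]
    constructor
    · intro hω i _
      split_ifs with hi
      · exact hω i hi
      · trivial
    · intro hω i hi
      simpa [hi] using hω i (Finset.mem_range.1 (hn hi))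
  · rw [← Finset.prod_subset hn]
    · exact Finset.prod_congr rfl fun i hi => by rw [if_pos hi, hp.map_returningTraj α hα i]
    · intro i _ hi
      rw [if_neg hi, Set.preimage_univ, measure_univ]

end ProbProcess

end TwoComp

theorem mainTheorem3 {V : Type*} {D : TwoComp.DistributedSystem V} (p : TwoComp.ProbProcess D)
    (hne : p.X₀.Nonempty) (hp : p.IsMarkov) :
    -- zero-one law, and the two characterizations
    (∀ α : p.X₀,
      MeasurableSet (TwoComp.returnsInfinitelyOften (α : TwoComp.GlobalState D)) ∧
      MeasurableSet {ω | TwoComp.returnTime (α : TwoComp.GlobalState D) ω ≠ ⊤} ∧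
      (p.P α (TwoComp.returnsInfinitelyOften (α : TwoComp.GlobalState D)) = 0 ∨
        p.P α (TwoComp.returnsInfinitelyOften (α : TwoComp.GlobalState D)) = 1) ∧
      (p.Recurrent α ↔
        p.P α {ω | TwoComp.returnTime (α : TwoComp.GlobalState D) ω ≠ ⊤} = 1) ∧
      (p.Transient α ↔
        p.P α {ω | TwoComp.returnTime (α : TwoComp.GlobalState D) ω ≠ ⊤} < 1)) ∧
    -- existence of a recurrent state
    (∃ α : p.X₀, p.Recurrent α) ∧
    -- the successive returning trajectories are almost surely finite, and i.i.d.
    (∀ α : p.X₀, p.Recurrent α →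
      (∀ᵐ ω ∂(p.P α), ∀ n, TwoComp.returningTraj (α : TwoComp.GlobalState D) n ω ≠ none) ∧
      iIndepFun (TwoComp.returningTraj (α : TwoComp.GlobalState D)) (p.P α) ∧
      ∀ m n, IdentDistrib (TwoComp.returningTraj (α : TwoComp.GlobalState D) m)
        (TwoComp.returningTraj (α : TwoComp.GlobalState D) n) (p.P α) (p.P α)) ∧
    -- states reachable from a recurrent state
    (∀ α β : p.X₀, p.Recurrent α → p.Reachable α β → p.Recurrent β ∧ p.Reachable β α) := by
  refine ⟨fun α => ⟨?_, ?_, ?_, hp.recurrent_iff α, hp.transient_iff α⟩, hp.exists_recurrent hne,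
    fun α hα => ⟨TwoComp.ProbProcess.ae_returningTraj_ne_none α hα,
      hp.iIndepFun_returningTraj α hα, hp.identDistrib_returningTraj α hα⟩,
    fun α β => hp.recurrent_of_reachable⟩
  · rw [TwoComp.returnsInfinitelyOften_eq]
    exact TwoComp.measurableSet_visitsInfinitelyOften _
  · rw [TwoComp.setOf_returnTime_ne_top]
    exact MeasurableSet.biUnion (Set.to_countable _) fun v _ => v.measurableSet_cylinder
  · have := p.isProbabilityMeasure α
    rcases (prob_le_one (μ := p.P α)
      (s := {ω | TwoComp.returnTime (α : TwoComp.GlobalState D) ω ≠ ⊤})).lt_or_eq with h | h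
    · exact Or.inl ((hp.transient_iff α).2 h)
    · exact Or.inr ((hp.recurrent_iff α).2 h)
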